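/- For $n\ge 1$ let $\mathcal B_n=\{-1,1\}^n$, and let $\langle\cdot,\cdot\rangle$ be the Euclidean inner product on $\mathbb R^n$. For $m\in\mathbb N$, $\beta,\eta\in\mathbb R$, $E>0$, $\mathcal I\subset[0,1]$ and i.i.d. random vectors $X_0,X_1,\dots,X_m\sim\mathcal N(0,I_n)$, put $Y_i(\tau)=\sqrt{1-\tau^2}\,X_0+\tau X_i$ for $1\le i\le m$, and let $\mathcal S(\beta,\eta,m,E,\mathcal I)$ be the (random) set of all $m$-tuples $(\sigma^{(1)},\dots,\sigma^{(m)})$ of elements of $\mathcal B_n$ such that (a) $\beta-\eta\le \frac1n\langle\sigma^{(i)},\sigma^{(j)}\rangle\le\beta$ for all $1\le i<j\le m$, and (b) for every $1\le i\le m$ there is $\tau_i\in\mathcal I$ with $\frac1{\sqrt n}\,|\langle\sigma^{(i)},Y_i(\tau_i)\rangle|\le 2^{-E}$. **Theorem 2.4.** Let $E_n>0$ be a sequence with $E_n=o(n)$, let $m_n$ be $2n/E_n$ rounded up or down to an integer, and for a function $g$ put $$\beta_n=1-\frac{2g(n)}{E_n},\qquad \eta_n=\frac{g(n)}{2n}.$$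 Suppose that one of the following holds: 1. $E_n=\omega(\sqrt{n\log_2 n})$, $g(n)\to\infty$ and $g(n)=o\!\left(\frac{E_n^2}{n\log_2 n}\right)$; or 2. for some $\epsilon\in(0,\frac15)$, $E_n=\omega\!\left(n(\log_2 n)^{-\frac15+\epsilon}\right)$ and $g(n)=n\left(\frac{E_n}{n}\right)^{2+\frac{\epsilon}{8}}$. Then for every $K\in\mathbb N$ there is $c>0$ such that for all sufficiently large $n$ and all $\mathcal I\subset[0,1]$ with $|\mathcal I|\le n^K$, $$\mathbb P\bigl(\mathcal S(\beta_n,\eta_n,m_n,E_n,\mathcal I)\neq\varnothing\bigr)\le e^{-cn}.$$ -/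

import Mathlib

open Filter MeasureTheory ProbabilityTheory Asymptotics
universe u

/-- The discrete cube `{-1, 1}^n` of spin configurations. -/
def spinCube (n : ℕ) : Set (Fin n → ℝ) :=
  {σ | ∀ k, σ k = -1 ∨ σ k = 1}

/-- The law `𝒩(0, I_n)` on `ℝⁿ`: independent standard normal coordinates. -/
noncomputable def stdNormalVec (n : ℕ) : Measure (Fin n → ℝ) :=
  Measure.pi fun _ => gaussianReal 0 1

/-- The interpolated instance `Y(τ) = √(1 - τ²) x₀ + τ x`. -/
noncomputable def corrInstance {n : ℕ} (x₀ x : Fin n → ℝ) (τ : ℝ) : Fin n → ℝ :=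
  Real.sqrt (1 - τ ^ 2) • x₀ + τ • x

/-- The set `𝒮(β, η, m, E, 𝓘)` for a realization `x = (x₀, x₁, …, x_m)` of the Gaussian vectors:
all `m`-tuples of spin configurations whose pairwise normalized inner products lie in
`[β - η, β]`, and such that the `i`-th one has energy at most `2^{-E}` for the instance
`Y_i(τ_i)`, for some `τ_i ∈ 𝓘`. The index `i : Fin m` stands for `i + 1` in `{1, …, m}`. -/
def nearGroundTuples {n m : ℕ} (β η E : ℝ) (I : Set ℝ) (x : Fin (m + 1) → Fin n → ℝ) :
    Set (Fin m → Fin n → ℝ) :=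
  {σ | (∀ i, σ i ∈ spinCube n) ∧
    (∀ i j, i < j → (1 / (n : ℝ)) * (σ i ⬝ᵥ σ j) ∈ Set.Icc (β - η) β) ∧
    (∀ i, ∃ τ ∈ I,
      (1 / Real.sqrt n) * |σ i ⬝ᵥ corrInstance (x 0) (x i.succ) τ| ≤ (2 : ℝ) ^ (-E))}

/-- `P(𝒮(β_n, η_n, m_n, E_n, 𝓘) ≠ ∅) ≤ exp(-Θ(n))` for all index sets `𝓘 ⊆ [0, 1]` with
`|𝓘| = n^{O(1)}`. The probability space, carrying i.i.d. `X_0, …, X_m ∼ 𝒩(0, I_n)`, is arbitrary;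
the rate `c` depends on the sequences and on the exponent `K` only. -/
def ensembleOGP (β η : ℕ → ℝ) (m : ℕ → ℕ) (E : ℕ → ℝ) : Prop :=
  ∀ K : ℕ, ∃ c : ℝ, 0 < c ∧ ∀ᶠ n : ℕ in atTop,
    ∀ I : Finset ℝ, (I : Set ℝ) ⊆ Set.Icc 0 1 → I.card ≤ n ^ K →
    ∀ (Ω : Type u) [MeasurableSpace Ω] (μ : Measure Ω) [IsProbabilityMeasure μ]
      (X : Fin (m n + 1) → Ω → Fin n → ℝ),
      (∀ i, HasLaw (X i) (stdNormalVec n) μ) → iIndepFun X μ →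
      μ.real {ω | (nearGroundTuples (β n) (η n) (E n) (I : Set ℝ) fun i => X i ω).Nonempty}
        ≤ Real.exp (-c * n)

/-!
The proof is a first moment computation. Fix a tuple `σ` with pairwise overlaps in `[β - η, β]` and
parameters `τ_i ∈ I`. The fields `⟨σ_i, Y_i(τ_i)⟩ / √n` form a centred Gaussian vector with covariance
`D R D + diag(τ_i²)`, where `R` is the overlap matrix and `D = diag(√(1 - τ_i²))`. Because
`m η ≲ (1 - β) / 2`, one has `R ≥ l • 1` with `l` of order `1 - β` (`mul_sum_sq_le_dotProduct_sum`), and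
then the covariance is at least `l • 1` too (`posSemidef_fieldCov_sub`). A Gaussian vector of this
kind has an independent component `𝒩(0, l • 1)`, so all `m` fields are at most `2 ^ (-E)` in absolute
value with probability at most `(2 ^ (-E) / √l) ^ m` (`measure_abs_le_of_charFun`); no density or
determinant is needed.

The number of tuples is at most `2 ^ n` times the `m`-th power of the volume of a Hamming ball of
radius `ρ n`, `ρ = 2g / E` (`card_overlapTuples_le`). Since `m E ≈ 2n`, the probability contributes
`2 ^ (-2n)` against the `2 ^ n` of the count, and the remaining factors, coming from the Hamming
balls, from `l` and from the at most `n ^ (K m)` choices of `τ`, are `exp (o(n))` as soon as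
`log n / E → 0` and `(n g / E²) (1 + log (E / g)) → 0` (`ensembleOGP_of_tendsto`). Both parameter
regimes satisfy these two conditions.
-/

/-! ### Small-ball probabilities and characteristic functions of Gaussian vectors -/

/-- An interval of length `2δ` has Gaussian measure at most `2δ` times the supremum of the density,
here bounded by `1 / (2√v)` instead of `1 / √(2πv)`. -/
lemma gaussianReal_Icc_le (v : NNReal) (hv : v ≠ 0) (a δ : ℝ) :
    gaussianReal 0 v (Set.Icc (a - δ) (a + δ)) ≤ ENNReal.ofReal (δ / Real.sqrt v) := by
  have hv' : (0 : ℝ) < v := by positivity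
  have hpi : (4 : ℝ) ≤ 2 * Real.pi := by linarith [Real.pi_gt_three]
  have hpdf : ∀ x, gaussianPDF 0 v x ≤ ENNReal.ofReal ((2 * Real.sqrt v)⁻¹) := by
    intro x
    refine ENNReal.ofReal_le_ofReal ?_
    rw [gaussianPDFReal]
    have h1 : 2 * Real.sqrt v ≤ Real.sqrt (2 * Real.pi * v) := by
      rw [show (2 : ℝ) * Real.sqrt v = Real.sqrt (4 * v) by
        rw [Real.sqrt_mul (by norm_num), show (4 : ℝ) = 2 ^ 2 by norm_num,
          Real.sqrt_sq (by norm_num)]]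
      exact Real.sqrt_le_sqrt (by nlinarith)
    have h2 : Real.exp (-(x - 0) ^ 2 / (2 * v)) ≤ 1 := by
      rw [Real.exp_le_one_iff]
      exact div_nonpos_of_nonpos_of_nonneg (by nlinarith [sq_nonneg (x - 0)]) (by positivity)
    have h3 : (Real.sqrt (2 * Real.pi * v))⁻¹ ≤ (2 * Real.sqrt v)⁻¹ :=
      inv_anti₀ (by positivity) h1
    calc _ ≤ (Real.sqrt (2 * Real.pi * v))⁻¹ * 1 := by gcongr
      _ ≤ _ := by simpa using h3
  rw [gaussianReal_apply 0 hv]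
  calc ∫⁻ x in Set.Icc (a - δ) (a + δ), gaussianPDF 0 v x
      ≤ ∫⁻ _ in Set.Icc (a - δ) (a + δ), ENNReal.ofReal ((2 * Real.sqrt v)⁻¹) :=
        lintegral_mono fun x => hpdf x
    _ = ENNReal.ofReal (δ / Real.sqrt v) := by
        rw [setLIntegral_const, Real.volume_Icc, ← ENNReal.ofReal_mul (by positivity)]
        congr 1
        field_simp
        ring

/-- Small-ball estimate: if `Z` is a centred Gaussian vector with covariance `v • 1 + S`, `S` positive
semidefinite (stated through its characteristic function), then `Z` is in law the sum of a vector of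
independent `𝒩(0, v)` coordinates and an independent Gaussian vector of covariance `S`. Conditionally
on the second summand, each coordinate lies in `[-δ, δ]` with probability at most `δ / √v`,
independently of the others. -/
lemma measure_abs_le_of_charFun {Ω : Type*} [MeasurableSpace Ω] (μ : Measure Ω)
    [IsProbabilityMeasure μ] {ι : Type*} [Fintype ι] [DecidableEq ι] (Z : Ω → ι → ℝ)
    (hZ : AEMeasurable Z μ) (S : Matrix ι ι ℝ) (hS : S.PosSemidef) (v : NNReal) (hv : v ≠ 0)
    (hchar : ∀ t : ι → ℝ, ∫ ω, Complex.exp (((t ⬝ᵥ Z ω : ℝ) : ℂ) * Complex.I) ∂μ =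
      Complex.exp (((-(v * (t ⬝ᵥ t) + t ⬝ᵥ S.mulVec t) / 2 : ℝ)) : ℂ))
    (δ : ℝ) :
    μ {ω | ∀ i, |Z ω i| ≤ δ} ≤ ENNReal.ofReal (δ / Real.sqrt v) ^ Fintype.card ι := by
  set ν₁ : Measure (EuclideanSpace ℝ ι) :=
    (Measure.pi fun _ : ι => gaussianReal 0 v).map (WithLp.toLp 2) with hν₁
  have : IsProbabilityMeasure ν₁ :=
    Measure.isProbabilityMeasure_map (by fun_prop)
  set ν₂ : Measure (EuclideanSpace ℝ ι) := multivariateGaussian 0 S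
  have hlaw : μ.map (fun ω => WithLp.toLp 2 (Z ω)) = ν₁ ∗ ν₂ := by
    have : IsProbabilityMeasure (μ.map (fun ω => (WithLp.toLp 2 (Z ω) : EuclideanSpace ℝ ι))) :=
      Measure.isProbabilityMeasure_map (by fun_prop)
    apply Measure.ext_of_charFun
    ext t
    rw [charFun_conv, charFun_multivariateGaussian hS, hν₁, charFun_pi, charFun_apply,
      integral_map (by fun_prop) (by fun_prop)]
    have := hchar t.ofLp
    simp_rw [charFun_gaussianReal, ← Complex.exp_sum]
    rw [← Complex.exp_add]
    convert this using 3
    · simp [PiLp.inner_apply, dotProduct, mul_comm]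
    · have h : ∀ i, (t i : ℂ) * ((0 : ℝ) : ℂ) * Complex.I - ((v : ℝ) : ℂ) * (t i : ℂ) ^ 2 / 2 =
          -(((v : ℝ) : ℂ) / 2) * ((t i : ℂ) * (t i : ℂ)) := fun i => by push_cast; ring
      simp_rw [h]
      rw [← Finset.mul_sum, inner_zero_right]
      simp only [dotProduct]
      push_cast
      ring
  set B : Set (EuclideanSpace ℝ ι) := {z | ∀ i, |z i| ≤ δ} with hB
  have hBm : MeasurableSet B := by
    rw [hB, Set.ofPred_forall]
    refine MeasurableSet.iInter fun i => measurableSet_le ?_ measurable_const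
    fun_prop
  have h0 : μ {ω | ∀ i, |Z ω i| ≤ δ} = (ν₁ ∗ ν₂) B := by
    rw [← hlaw, Measure.map_apply_of_aemeasurable (by fun_prop) hBm]
    rfl
  -- With the second summand `y` frozen, the event is a box for the product measure.
  have hslice : ∀ y : EuclideanSpace ℝ ι, ν₁ ((fun x => x + y) ⁻¹' B) ≤
      ENNReal.ofReal (δ / Real.sqrt v) ^ Fintype.card ι := by
    intro y
    rw [hν₁, Measure.map_apply (by fun_prop) (hBm.preimage (by fun_prop))]
    have : (WithLp.toLp 2 : (ι → ℝ) → EuclideanSpace ℝ ι) ⁻¹' ((fun x => x + y) ⁻¹' B) =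
        Set.univ.pi fun i => Set.Icc (-y i - δ) (-y i + δ) := by
      ext x
      simp only [hB, Set.mem_preimage, Set.mem_ofPred_eq, Set.mem_pi, Set.mem_univ, true_imp_iff,
        Set.mem_Icc, abs_le]
      refine forall_congr' fun i => ?_
      simp only [PiLp.add_apply]
      constructor <;> rintro ⟨h1, h2⟩ <;> constructor <;> linarith
    rw [this, Measure.pi_pi]
    calc _ ≤ ∏ _i : ι, ENNReal.ofReal (δ / Real.sqrt v) :=
          Finset.prod_le_prod' fun i _ => gaussianReal_Icc_le v hv _ δ
      _ = _ := by simp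
  rw [h0, Measure.conv, Measure.map_apply (by fun_prop) hBm,
    Measure.prod_apply_symm (hBm.preimage (by fun_prop))]
  calc _ ≤ ∫⁻ _, ENNReal.ofReal (δ / Real.sqrt v) ^ Fintype.card ι ∂ν₂ :=
        lintegral_mono fun y => hslice y
    _ = _ := by simp

lemma integral_exp_stdNormalVec {n : ℕ} (c : Fin n → ℝ) :
    ∫ x, Complex.exp (((c ⬝ᵥ x : ℝ) : ℂ) * Complex.I) ∂(stdNormalVec n) =
      Complex.exp (((-(c ⬝ᵥ c) / 2 : ℝ)) : ℂ) := by
  rw [stdNormalVec]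
  simp only [dotProduct, Complex.ofReal_sum, Finset.sum_mul, Complex.exp_sum]
  rw [integral_fintype_prod_eq_prod (f := fun i x => Complex.exp (((c i * x : ℝ) : ℂ) * Complex.I))]
  have : ∀ i, ∫ x, Complex.exp (((c i * x : ℝ) : ℂ) * Complex.I) ∂(gaussianReal 0 1) =
      Complex.exp (((-(c i * c i) / 2 : ℝ)) : ℂ) := by
    intro i
    have := charFun_gaussianReal (μ := 0) (v := 1) (c i)
    rw [charFun_apply_real] at this
    push_cast
    rw [this]
    congr 1
    push_cast
    ring
  simp_rw [this, ← Complex.exp_sum]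
  congr 1
  push_cast
  rw [← Finset.sum_div, Finset.sum_neg_distrib]

instance isProbabilityMeasure_stdNormalVec (n : ℕ) : IsProbabilityMeasure (stdNormalVec n) := by
  unfold stdNormalVec; infer_instance

lemma integral_exp_of_iIndepFun {Ω : Type*} [MeasurableSpace Ω] {μ : Measure Ω}
    [IsProbabilityMeasure μ] {ι : Type*} [Fintype ι] {n : ℕ} {X : ι → Ω → Fin n → ℝ}
    (hX : ∀ a, HasLaw (X a) (stdNormalVec n) μ) (hind : iIndepFun X μ) (c : ι → Fin n → ℝ) :
    ∫ ω, Complex.exp (((∑ a, c a ⬝ᵥ X a ω : ℝ) : ℂ) * Complex.I) ∂μ =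
      Complex.exp (((-(∑ a, c a ⬝ᵥ c a) / 2 : ℝ)) : ℂ) := by
  have hlaw := hind.map_fun_eq_pi_map (fun a => (hX a).aemeasurable)
  simp_rw [fun a => (hX a).map_eq] at hlaw
  have hmeas : AEMeasurable (fun ω a => X a ω) μ :=
    aemeasurable_pi_lambda _ fun a => (hX a).aemeasurable
  have h1 : ∫ ω, Complex.exp (((∑ a, c a ⬝ᵥ X a ω : ℝ) : ℂ) * Complex.I) ∂μ =
      ∫ x : ι → Fin n → ℝ, Complex.exp (((∑ a, c a ⬝ᵥ x a : ℝ) : ℂ) * Complex.I)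
        ∂(Measure.pi fun _ : ι => stdNormalVec n) := by
    rw [← hlaw, integral_map hmeas]
    refine Continuous.aestronglyMeasurable ?_
    refine Complex.continuous_exp.comp ((Complex.continuous_ofReal.comp ?_).mul continuous_const)
    simp only [dotProduct]
    fun_prop
  rw [h1]
  simp only [Complex.ofReal_sum, Finset.sum_mul, Complex.exp_sum]
  rw [integral_fintype_prod_eq_prod
    (f := fun a x => Complex.exp (((c a ⬝ᵥ x : ℝ) : ℂ) * Complex.I))]
  simp_rw [integral_exp_stdNormalVec, ← Complex.exp_sum]
  congr 1
  push_cast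
  rw [← Finset.sum_div, Finset.sum_neg_distrib]

/-! ### Counting tuples of spin configurations -/

/-- The discrete cube `{-1, 1}^n` as a `Finset`; see `mem_spinFinset`. -/
noncomputable def spinFinset (n : ℕ) : Finset (Fin n → ℝ) :=
  Fintype.piFinset fun _ => {-1, 1}

lemma mem_spinFinset {n : ℕ} {σ : Fin n → ℝ} : σ ∈ spinFinset n ↔ σ ∈ spinCube n := by
  simp [spinFinset, spinCube]

lemma card_spinFinset (n : ℕ) : (spinFinset n).card = 2 ^ n := by
  rw [spinFinset, Fintype.card_piFinset]
  simp [Finset.card_pair (show (-1 : ℝ) ≠ 1 by norm_num)]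

lemma dotProduct_self_of_mem_spinCube {n : ℕ} {σ : Fin n → ℝ} (hσ : σ ∈ spinCube n) :
    σ ⬝ᵥ σ = n := by
  have : ∀ k, σ k * σ k = 1 := fun k => by rcases hσ k with h | h <;> simp [h]
  simp [dotProduct, this]

open Classical in
/-- Volume of a Hamming ball of radius `ρ n`, by the exponential moment method: each `σ'` is given the
weight `ρ ^ d(σ, σ')`, with total weight `(1 + ρ) ^ n` and at least `ρ ^ (ρ n)` on the ball. -/
lemma card_overlap_ge_le {n : ℕ} {σ : Fin n → ℝ} (hσ : σ ∈ spinCube n) {ρ : ℝ} (h0 : 0 < ρ)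
    (h1 : ρ ≤ 1) :
    (((spinFinset n).filter fun σ' => (1 - 2 * ρ) * n ≤ σ ⬝ᵥ σ').card : ℝ) ≤
      Real.exp (n * (ρ * (1 - Real.log ρ))) := by
  set L : ℝ := -Real.log ρ with hL
  have hL0 : 0 ≤ L := by have := Real.log_nonpos h0.le h1; linarith
  have hsum : ∑ σ' ∈ spinFinset n, Real.exp (-L * ((n - σ ⬝ᵥ σ') / 2)) = (1 + ρ) ^ n := by
    have h2 : ∀ σ' : Fin n → ℝ, Real.exp (-L * ((n - σ ⬝ᵥ σ') / 2)) =
        ∏ k, Real.exp (-L * ((1 - σ k * σ' k) / 2)) := by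
      intro σ'
      rw [← Real.exp_sum, ← Finset.mul_sum, ← Finset.sum_div, Finset.sum_sub_distrib]
      simp [dotProduct]
    simp_rw [h2]
    rw [spinFinset, Finset.sum_prod_piFinset
      (g := fun k s => Real.exp (-L * ((1 - σ k * s) / 2)))]
    have h3 : ∀ k, ∑ s ∈ ({-1, 1} : Finset ℝ), Real.exp (-L * ((1 - σ k * s) / 2)) = 1 + ρ := by
      intro k
      rw [Finset.sum_pair (by norm_num)]
      rcases hσ k with h | h <;> norm_num [h, hL, Real.exp_log h0]
      ring
    simp only [h3, Finset.prod_const, Finset.card_univ, Fintype.card_fin]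
  have hle : (((spinFinset n).filter fun σ' => (1 - 2 * ρ) * n ≤ σ ⬝ᵥ σ').card : ℝ) *
      Real.exp (-L * (ρ * n)) ≤ (1 + ρ) ^ n := by
    rw [← hsum, ← nsmul_eq_mul, ← Finset.sum_const]
    refine (Finset.sum_le_sum fun σ' h => ?_).trans
      (Finset.sum_le_sum_of_subset_of_nonneg (Finset.filter_subset _ _)
        fun _ _ _ => (Real.exp_pos _).le)
    rw [Finset.mem_filter] at h
    refine Real.exp_le_exp.2 ?_
    have : (n - σ ⬝ᵥ σ') / 2 ≤ ρ * n := by linarith [h.2]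
    nlinarith
  have hpow : (1 + ρ) ^ n ≤ Real.exp (n * ρ) := by
    rw [Real.exp_nat_mul]
    gcongr
    linarith [Real.add_one_le_exp ρ]
  calc _ = (((spinFinset n).filter fun σ' => (1 - 2 * ρ) * n ≤ σ ⬝ᵥ σ').card : ℝ) *
        Real.exp (-L * (ρ * n)) * Real.exp (L * (ρ * n)) := by
          rw [mul_assoc, ← Real.exp_add]; simp
    _ ≤ Real.exp (n * ρ) * Real.exp (L * (ρ * n)) := by gcongr; exact hle.trans hpow
    _ = _ := by rw [← Real.exp_add]; congr 1; simp only [hL]; ring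

open Classical in
/-- The finite set of all `m`-tuples of spin configurations with pairwise overlaps in
`[β - η, β]`. -/
noncomputable def overlapTuples (n m : ℕ) (β η : ℝ) : Finset (Fin m → Fin n → ℝ) :=
  (Fintype.piFinset fun _ => spinFinset n).filter fun σ =>
    ∀ i j, i < j → (1 / (n : ℝ)) * (σ i ⬝ᵥ σ j) ∈ Set.Icc (β - η) β

lemma mem_overlapTuples {n m : ℕ} {β η : ℝ} {σ : Fin m → Fin n → ℝ} :
    σ ∈ overlapTuples n m β η ↔ (∀ i, σ i ∈ spinCube n) ∧
      ∀ i j, i < j → (1 / (n : ℝ)) * (σ i ⬝ᵥ σ j) ∈ Set.Icc (β - η) β := by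
  simp [overlapTuples, mem_spinFinset]

/-- Choose the first configuration freely; all configurations of the tuple, the first included, then
lie in a Hamming ball around it. -/
lemma card_overlapTuples_le {n m : ℕ} (hn : 0 < n) (hm : 0 < m) {β η ρ : ℝ} (h0 : 0 < ρ)
    (h1 : ρ ≤ 1) (hρ : 1 - 2 * ρ ≤ β - η) :
    ((overlapTuples n m β η).card : ℝ) ≤
      2 ^ n * Real.exp (n * (ρ * (1 - Real.log ρ))) ^ m := by
  classical
  have hn' : (0 : ℝ) < n := by exact_mod_cast hn
  have : NeZero m := ⟨hm.ne'⟩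
  set V := fun σ : Fin n → ℝ => (spinFinset n).filter fun σ' => (1 - 2 * ρ) * n ≤ σ ⬝ᵥ σ'
  have hsub : overlapTuples n m β η ⊆
      (spinFinset n).biUnion fun σ => Fintype.piFinset fun _ : Fin m => V σ := by
    intro σ hσ
    rw [mem_overlapTuples] at hσ
    rw [Finset.mem_biUnion]
    refine ⟨σ 0, mem_spinFinset.2 (hσ.1 0), ?_⟩
    rw [Fintype.mem_piFinset]
    intro j
    refine Finset.mem_filter.2 ⟨mem_spinFinset.2 (hσ.1 j), ?_⟩
    rcases eq_or_ne j 0 with rfl | hj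
    · rw [dotProduct_self_of_mem_spinCube (hσ.1 0)]
      nlinarith
    · have h := (hσ.2 0 j (Fin.pos_iff_ne_zero.2 hj)).1
      rw [one_div, ← div_eq_inv_mul, le_div_iff₀ hn'] at h
      nlinarith
  calc ((overlapTuples n m β η).card : ℝ)
      ≤ ∑ σ ∈ spinFinset n, ((Fintype.piFinset fun _ : Fin m => V σ).card : ℝ) := by
        exact_mod_cast (Finset.card_le_card hsub).trans Finset.card_biUnion_le
    _ ≤ ∑ σ ∈ spinFinset n, Real.exp (n * (ρ * (1 - Real.log ρ))) ^ m := by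
        refine Finset.sum_le_sum fun σ hσ => ?_
        rw [Fintype.card_piFinset]
        simp only [Finset.prod_const, Finset.card_univ, Fintype.card_fin, Nat.cast_pow]
        gcongr
        exact card_overlap_ge_le (mem_spinFinset.1 hσ) h0 h1
    _ = _ := by simp [card_spinFinset]

/-! ### Covariance of the fields of a tuple -/

/-- The Gram matrix of the tuple, divided by `n`, is at least `l • 1`: it is
`(1 - β) • 1 + β 𝟙𝟙ᵀ - P`, where `P` has zero diagonal and entries in `[0, η]`, hence operator norm
at most `m η`. -/
lemma mul_sum_sq_le_dotProduct_sum {n m : ℕ} (hn : 0 < n) {β η l : ℝ} (hβ : 0 ≤ β) (hη : 0 ≤ η)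
    (hl : l + m * η ≤ 1 - β) {σ : Fin m → Fin n → ℝ} (hσ : σ ∈ overlapTuples n m β η)
    (u : Fin m → ℝ) :
    l * ∑ i, u i ^ 2 ≤ ∑ i, ∑ j, u i * u j * ((1 / (n : ℝ)) * (σ i ⬝ᵥ σ j)) := by
  rw [mem_overlapTuples] at hσ
  have hn' : (n : ℝ) ≠ 0 := by exact_mod_cast hn.ne'
  have hoff : ∀ i j, i ≠ j → (1 / (n : ℝ)) * (σ i ⬝ᵥ σ j) ∈ Set.Icc (β - η) β := by
    intro i j hij
    rcases lt_or_gt_of_ne hij with h | h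
    · exact hσ.2 i j h
    · rw [dotProduct_comm]; exact hσ.2 j i h
  have hterm : ∀ i j, u i * u j * β + (if i = j then (1 - β) * u i ^ 2 else 0) -
      η * (|u i| * |u j|) ≤ u i * u j * ((1 / (n : ℝ)) * (σ i ⬝ᵥ σ j)) := by
    intro i j
    split_ifs with h
    · subst h
      rw [dotProduct_self_of_mem_spinCube (hσ.1 i), one_div, inv_mul_cancel₀ hn']
      have : 0 ≤ η * (|u i| * |u i|) := by positivity
      nlinarith
    · have h1 := hoff i j h
      have h2 : u i * u j * (β - (1 / (n : ℝ)) * (σ i ⬝ᵥ σ j)) ≤ |u i| * |u j| * η := by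
        rw [← abs_mul]
        refine (mul_le_mul_of_nonneg_right (le_abs_self _) (by linarith [h1.2])).trans ?_
        exact mul_le_mul_of_nonneg_left (by linarith [h1.1]) (abs_nonneg _)
      linarith
  -- Cauchy–Schwarz bounds the contribution of `P`.
  have hcs : (∑ i, |u i|) ^ 2 ≤ m * ∑ i, u i ^ 2 := by
    have := sq_sum_le_card_mul_sum_sq (s := Finset.univ) (f := fun i => |u i|)
    simpa using this
  have hsum := Finset.sum_le_sum fun i (_ : i ∈ Finset.univ) =>
    Finset.sum_le_sum fun j (_ : j ∈ Finset.univ) => hterm i j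
  have hL : ∑ i, ∑ j, (u i * u j * β + (if i = j then (1 - β) * u i ^ 2 else 0) -
      η * (|u i| * |u j|)) = β * (∑ i, u i) ^ 2 + (1 - β) * ∑ i, u i ^ 2 -
        η * (∑ i, |u i|) ^ 2 := by
    have hdouble : ∀ (b : ℝ) (w : Fin m → ℝ),
        ∑ i, ∑ j, b * (w i * w j) = b * (∑ i, w i) ^ 2 := by
      intro b w
      rw [sq, Finset.sum_mul_sum]
      simp only [Finset.mul_sum]
    simp only [Finset.sum_sub_distrib, Finset.sum_add_distrib, Finset.sum_ite_eq, Finset.mem_univ,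
      if_true]
    rw [hdouble η fun i => |u i|, ← Finset.mul_sum, ← hdouble β u]
    simp only [mul_comm β]
  rw [hL] at hsum
  have hs : 0 ≤ ∑ i, u i ^ 2 := Finset.sum_nonneg fun i _ => sq_nonneg _
  have h3 : 0 ≤ β * (∑ i, u i) ^ 2 := by positivity
  have h4 := mul_le_mul_of_nonneg_left hcs hη
  nlinarith [mul_le_mul_of_nonneg_right hl hs]

/-- The covariance matrix of the normalized fields `⟨σ_i, Y_i(τ_i)⟩ / √n`: with
`D = diag(√(1 - τ_i²))`, it is `D R D + diag(τ_i²)`, where `R` is the matrix of normalized overlaps.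
This uses `σ_i ∈ {-1, 1}^n`, which makes the contribution of `τ_i X_i` to the variance `τ_i²`. -/
noncomputable def fieldCov {n m : ℕ} (σ : Fin m → Fin n → ℝ) (τ : Fin m → ℝ) :
    Matrix (Fin m) (Fin m) ℝ :=
  Matrix.of fun i j => Real.sqrt (1 - τ i ^ 2) * Real.sqrt (1 - τ j ^ 2) *
    ((1 / (n : ℝ)) * (σ i ⬝ᵥ σ j)) + if i = j then τ i ^ 2 else 0

lemma dotProduct_fieldCov_mulVec {n m : ℕ} (σ : Fin m → Fin n → ℝ) (τ t : Fin m → ℝ) :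
    t ⬝ᵥ (fieldCov σ τ).mulVec t = ∑ i, ∑ j, (t i * Real.sqrt (1 - τ i ^ 2)) *
      (t j * Real.sqrt (1 - τ j ^ 2)) * ((1 / (n : ℝ)) * (σ i ⬝ᵥ σ j)) + ∑ i, (t i * τ i) ^ 2 := by
  simp only [dotProduct, Matrix.mulVec, fieldCov, Matrix.of_apply, add_mul, ite_mul, zero_mul,
    Finset.sum_add_distrib, Finset.sum_ite_eq, Finset.mem_univ, if_true, mul_add]
  congr 1
  · refine Finset.sum_congr rfl fun i _ => ?_
    rw [Finset.mul_sum]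
    exact Finset.sum_congr rfl fun j _ => by ring
  · exact Finset.sum_congr rfl fun i _ => by ring

/-- Since `D² + diag(τ_i²) = 1`, a lower bound `l ≤ 1` on the overlap matrix passes to the covariance
matrix, whatever the correlation parameters are. -/
lemma posSemidef_fieldCov_sub {n m : ℕ} (hn : 0 < n) {β η l : ℝ} (hβ : 0 ≤ β) (hη : 0 ≤ η)
    (hl1 : l ≤ 1) (hl : l + m * η ≤ 1 - β) {σ : Fin m → Fin n → ℝ}
    (hσ : σ ∈ overlapTuples n m β η) {τ : Fin m → ℝ} (hτ : ∀ i, τ i ∈ Set.Icc (0 : ℝ) 1) :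
    (fieldCov σ τ - l • (1 : Matrix (Fin m) (Fin m) ℝ)).PosSemidef := by
  refine Matrix.PosSemidef.of_dotProduct_mulVec_nonneg ?_ fun t => ?_
  · ext i j
    by_cases h : i = j
    · subst h; simp
    · simp [fieldCov, h, Ne.symm h, mul_comm, dotProduct_comm]
  · have h1 := mul_sum_sq_le_dotProduct_sum hn hβ hη hl hσ
      fun i => t i * Real.sqrt (1 - τ i ^ 2)
    have h2 : l * ∑ i, t i ^ 2 ≤ l * ∑ i, (t i * Real.sqrt (1 - τ i ^ 2)) ^ 2 +
        ∑ i, (t i * τ i) ^ 2 := by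
      rw [Finset.mul_sum, Finset.mul_sum, ← Finset.sum_add_distrib]
      refine Finset.sum_le_sum fun i _ => ?_
      have hi := hτ i
      rw [mul_pow, Real.sq_sqrt (by nlinarith [hi.1, hi.2])]
      nlinarith [mul_nonneg (sub_nonneg.2 hl1) (sq_nonneg (t i * τ i))]
    rw [star_trivial, Matrix.sub_mulVec, dotProduct_sub, dotProduct_fieldCov_mulVec,
      Matrix.smul_mulVec, Matrix.one_mulVec, dotProduct_smul, smul_eq_mul,
      show t ⬝ᵥ t = ∑ i, t i ^ 2 by simp [dotProduct, sq]]
    linarith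

lemma integral_exp_field {Ω : Type*} [MeasurableSpace Ω] {μ : Measure Ω}
    [IsProbabilityMeasure μ] {n m : ℕ} (hn : 0 < n) {X : Fin (m + 1) → Ω → Fin n → ℝ}
    (hX : ∀ a, HasLaw (X a) (stdNormalVec n) μ) (hind : iIndepFun X μ)
    {σ : Fin m → Fin n → ℝ} (hσ : ∀ i, σ i ∈ spinCube n) (τ t : Fin m → ℝ) :
    ∫ ω, Complex.exp (((t ⬝ᵥ fun i => (1 / Real.sqrt n) *
      (σ i ⬝ᵥ corrInstance (X 0 ω) (X i.succ ω) (τ i)) : ℝ) : ℂ) * Complex.I) ∂μ =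
      Complex.exp (((-(t ⬝ᵥ (fieldCov σ τ).mulVec t) / 2 : ℝ)) : ℂ) := by
  have hn' : (0 : ℝ) < n := by exact_mod_cast hn
  set u : Fin m → ℝ := fun i => t i * Real.sqrt (1 - τ i ^ 2) with hu
  -- coefficients of `X_0`, and of `X_{i+1}`, in the linear form `⟨t, Z⟩`
  set c : Fin (m + 1) → Fin n → ℝ := Fin.cons ((1 / Real.sqrt n) • ∑ i, u i • σ i)
    fun i => ((1 / Real.sqrt n) * (t i * τ i)) • σ i with hc
  have hlin : ∀ x : Fin (m + 1) → Fin n → ℝ, (t ⬝ᵥ fun i => (1 / Real.sqrt n) *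
      (σ i ⬝ᵥ corrInstance (x 0) (x i.succ) (τ i))) = ∑ a, c a ⬝ᵥ x a := by
    intro x
    rw [Fin.sum_univ_succ]
    simp only [hc, Fin.cons_zero, Fin.cons_succ, smul_dotProduct, sum_dotProduct, smul_eq_mul,
      corrInstance, dotProduct_add, dotProduct_smul]
    rw [Finset.mul_sum, ← Finset.sum_add_distrib, dotProduct]
    exact Finset.sum_congr rfl fun i _ => by simp only [hu]; ring
  have hvar : ∑ a, c a ⬝ᵥ c a = t ⬝ᵥ (fieldCov σ τ).mulVec t := by
    rw [Fin.sum_univ_succ, dotProduct_fieldCov_mulVec]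
    have hsq : (1 / Real.sqrt n) * (1 / Real.sqrt n) = 1 / (n : ℝ) := by
      rw [div_mul_div_comm, Real.mul_self_sqrt hn'.le, one_mul]
    simp only [hc, Fin.cons_zero, Fin.cons_succ, smul_dotProduct, dotProduct_smul, smul_eq_mul,
      sum_dotProduct, dotProduct_sum]
    congr 1
    · simp only [Finset.mul_sum]
      refine Finset.sum_congr rfl fun i _ => Finset.sum_congr rfl fun j _ => ?_
      rw [← hsq, dotProduct_comm (σ j)]
      simp only [hu]
      ring
    · refine Finset.sum_congr rfl fun i _ => ?_
      rw [dotProduct_self_of_mem_spinCube (hσ i)]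
      calc _ = ((1 / Real.sqrt n) * (1 / Real.sqrt n)) * n * (t i * τ i) ^ 2 := by ring
        _ = _ := by rw [hsq, one_div, inv_mul_cancel₀ hn'.ne', one_mul]
  have := integral_exp_of_iIndepFun hX hind c
  rw [hvar] at this
  rw [← this]
  congr 1
  ext ω
  rw [← hlin fun a => X a ω]

/-! ### The union bound -/

lemma measure_fields_le {Ω : Type*} [MeasurableSpace Ω] {μ : Measure Ω}
    [IsProbabilityMeasure μ] {n m : ℕ} (hn : 0 < n) {X : Fin (m + 1) → Ω → Fin n → ℝ}
    (hX : ∀ a, HasLaw (X a) (stdNormalVec n) μ) (hind : iIndepFun X μ)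
    {β η l : ℝ} (hβ : 0 ≤ β) (hη : 0 ≤ η) (hl0 : 0 < l) (hl1 : l ≤ 1) (hl : l + m * η ≤ 1 - β)
    {σ : Fin m → Fin n → ℝ} (hσ : σ ∈ overlapTuples n m β η) {τ : Fin m → ℝ}
    (hτ : ∀ i, τ i ∈ Set.Icc (0 : ℝ) 1) {δ : ℝ} (hδ : 0 ≤ δ) :
    μ.real {ω | ∀ i, (1 / Real.sqrt n) *
      |σ i ⬝ᵥ corrInstance (X 0 ω) (X i.succ ω) (τ i)| ≤ δ} ≤ (δ / Real.sqrt l) ^ m := by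
  have hmem := (mem_overlapTuples.1 hσ).1
  set v : NNReal := ⟨l, hl0.le⟩
  have hv : v ≠ 0 := fun h => hl0.ne' (congrArg NNReal.toReal h)
  have h := measure_abs_le_of_charFun μ
    (fun ω i => (1 / Real.sqrt n) * (σ i ⬝ᵥ corrInstance (X 0 ω) (X i.succ ω) (τ i)))
    (by
      refine aemeasurable_pi_lambda _ fun i => ?_
      have h0 := (hX 0).aemeasurable
      have h1 := (hX i.succ).aemeasurable
      have hc : Measurable fun p : (Fin n → ℝ) × (Fin n → ℝ) =>
          σ i ⬝ᵥ corrInstance p.1 p.2 (τ i) := by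
        simp only [dotProduct, corrInstance, Pi.add_apply, Pi.smul_apply]
        fun_prop
      exact (hc.comp_aemeasurable (h0.prodMk h1)).const_mul (1 / Real.sqrt n)) _
    (posSemidef_fieldCov_sub hn hβ hη hl1 hl hσ hτ) v hv
    (by
      intro t
      rw [integral_exp_field hn hX hind hmem τ t]
      congr 4
      rw [Matrix.sub_mulVec, dotProduct_sub, Matrix.smul_mulVec, Matrix.one_mulVec,
        dotProduct_smul, smul_eq_mul]
      change _ = l * (t ⬝ᵥ t) + _
      ring) δ
  rw [Fintype.card_fin, ← ENNReal.ofReal_pow (by positivity)] at h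
  refine ENNReal.toReal_le_of_le_ofReal (by positivity) (le_trans (le_of_eq ?_) h)
  congr 1
  ext ω
  simp [abs_mul, abs_of_nonneg (Real.sqrt_nonneg _)]

/-- First moment bound at fixed `n`: a union bound over the tuples with prescribed overlaps and over
the choices of `τ_i ∈ I`. -/
lemma measure_nearGroundTuples_nonempty_le {Ω : Type*} [MeasurableSpace Ω] {μ : Measure Ω}
    [IsProbabilityMeasure μ] {n m : ℕ} (hn : 0 < n) (hm : 0 < m) {X : Fin (m + 1) → Ω → Fin n → ℝ}
    (hX : ∀ a, HasLaw (X a) (stdNormalVec n) μ) (hind : iIndepFun X μ)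
    {β η l ρ : ℝ} (hβ : 0 ≤ β) (hη : 0 ≤ η) (hl0 : 0 < l) (hl1 : l ≤ 1) (hl : l + m * η ≤ 1 - β)
    (hρ0 : 0 < ρ) (hρ1 : ρ ≤ 1) (hρ : 1 - 2 * ρ ≤ β - η) (E : ℝ) (I : Finset ℝ)
    (hI : (I : Set ℝ) ⊆ Set.Icc 0 1) :
    μ.real {ω | (nearGroundTuples β η E (I : Set ℝ) fun i => X i ω).Nonempty} ≤
      2 ^ n * Real.exp (n * (ρ * (1 - Real.log ρ))) ^ m * (I.card : ℝ) ^ m *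
        ((2 : ℝ) ^ (-E) / Real.sqrt l) ^ m := by
  classical
  set T := overlapTuples n m β η ×ˢ Fintype.piFinset fun _ : Fin m => I with hT
  have hsub : {ω | (nearGroundTuples β η E (I : Set ℝ) fun i => X i ω).Nonempty} ⊆
      ⋃ p ∈ T, {ω | ∀ i, (1 / Real.sqrt n) *
        |p.1 i ⬝ᵥ corrInstance (X 0 ω) (X i.succ ω) (p.2 i)| ≤ (2 : ℝ) ^ (-E)} := by
    rintro ω ⟨σ, hσ, hov, hen⟩
    choose τ hτI hτ using hen
    refine Set.mem_biUnion (x := (σ, τ)) ?_ hτ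
    exact Finset.mem_product.2 ⟨mem_overlapTuples.2 ⟨hσ, hov⟩, Fintype.mem_piFinset.2 hτI⟩
  calc _ ≤ μ.real (⋃ p ∈ T, {ω | ∀ i, (1 / Real.sqrt n) *
        |p.1 i ⬝ᵥ corrInstance (X 0 ω) (X i.succ ω) (p.2 i)| ≤ (2 : ℝ) ^ (-E)}) :=
        measureReal_mono hsub (measure_ne_top _ _)
    _ ≤ ∑ p ∈ T, μ.real {ω | ∀ i, (1 / Real.sqrt n) *
        |p.1 i ⬝ᵥ corrInstance (X 0 ω) (X i.succ ω) (p.2 i)| ≤ (2 : ℝ) ^ (-E)} :=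
        measureReal_biUnion_finset_le _ _
    _ ≤ ∑ _p ∈ T, ((2 : ℝ) ^ (-E) / Real.sqrt l) ^ m := by
        refine Finset.sum_le_sum fun p hp => ?_
        have hp' := Finset.mem_product.1 hp
        exact measure_fields_le hn hX hind hβ hη hl0 hl1 hl hp'.1
          (fun i => hI (Fintype.mem_piFinset.1 hp'.2 i)) (by positivity)
    _ = (overlapTuples n m β η).card * (I.card : ℝ) ^ m * ((2 : ℝ) ^ (-E) / Real.sqrt l) ^ m := by
        rw [Finset.sum_const, nsmul_eq_mul, hT, Finset.card_product, Fintype.card_piFinset]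
        simp
    _ ≤ _ := by
        gcongr
        exact card_overlapTuples_le hn hm hρ0 hρ1 hρ

/-! ### Asymptotics of the exponent -/

/-- The first moment bound with the choices `ρ = 2g / E` and `l = g / (2E)`. As `m ≈ 2n / E`, the count
`2 ^ n` is beaten by `2 ^ (-E m) ≈ 2 ^ (-2n)`; the remaining terms in the exponent are the errors to
be shown to be `o(n)`. -/
lemma firstMoment_bound_le {n m : ℕ} (hn : 2 ≤ n) {g E : ℝ} (hg : 1 ≤ g) (hgE : 4 * g ≤ E)
    (hEn : E ≤ n) (hm : |(m : ℝ) - 2 * n / E| < 1) (K : ℕ) :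
    2 ^ n * Real.exp (n * ((2 * g / E) * (1 - Real.log (2 * g / E)))) ^ m * ((n : ℝ) ^ K) ^ m *
        ((2 : ℝ) ^ (-E) / Real.sqrt (g / (2 * E))) ^ m ≤
      Real.exp (n * (-Real.log 2 + E / n * Real.log 2 +
        6 * (n * g / E ^ 2 * (1 + Real.log (E / g))) + 3 * (K + 1) * (Real.log n / E))) := by
  have hn2 : (2 : ℝ) ≤ n := by exact_mod_cast hn
  have hn0 : (0 : ℝ) < n := by linarith
  have hE0 : 0 < E := by linarith
  have hg0 : 0 < g := by linarith
  have hl2 : 0 < Real.log 2 := Real.log_pos (by norm_num)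
  have hm' := abs_lt.1 hm
  have hmE : 2 * n - E ≤ m * E := by
    have : 2 * n / E - 1 ≤ m := by linarith [hm'.1]
    calc 2 * n - E = (2 * n / E - 1) * E := by field_simp
      _ ≤ m * E := by gcongr
  have hmle : (m : ℝ) ≤ 3 * n / E := by
    have : 1 ≤ n / E := by rw [le_div_iff₀ hE0]; linarith
    calc (m : ℝ) ≤ 2 * n / E + n / E := by linarith [hm'.2]
      _ = _ := by ring
  have hlogEg : 0 ≤ Real.log (E / g) := Real.log_nonneg (by rw [le_div_iff₀ hg0]; linarith)
  have hlogn : Real.log 2 ≤ Real.log n := Real.log_le_log (by norm_num) hn2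
  -- Since `1 ≤ g` and `E ≤ n`, the factor `1 / √l` costs at most `n`.
  have hbase : (2 : ℝ) ^ (-E) / Real.sqrt (g / (2 * E)) ≤
      Real.exp (-(E * Real.log 2) + Real.log n) := by
    have h1 : (1 : ℝ) / n ≤ Real.sqrt (g / (2 * E)) := by
      refine Real.le_sqrt_of_sq_le ?_
      rw [div_pow, one_pow, div_le_div_iff₀ (by positivity) (by positivity)]
      nlinarith
    rw [div_le_iff₀ (by positivity), Real.exp_add, Real.exp_log hn0,
      Real.rpow_def_of_pos (by norm_num), show Real.log 2 * -E = -(E * Real.log 2) by ring]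
    have : 1 ≤ n * Real.sqrt (g / (2 * E)) := by
      rw [div_le_iff₀ hn0] at h1; linarith
    have h2 := Real.exp_pos (-(E * Real.log 2))
    nlinarith
  have hent : (n : ℝ) * ((2 * g / E) * (1 - Real.log (2 * g / E))) ≤
      n * ((2 * g / E) * (1 + Real.log (E / g))) := by
    have : -Real.log (2 * g / E) ≤ Real.log (E / g) := by
      rw [← Real.log_inv, inv_div]
      refine Real.log_le_log (by positivity) ?_
      gcongr
      linarith
    gcongr
    linarith
  have hpow : (n : ℝ) ^ K = Real.exp (K * Real.log n) := by
    rw [Real.exp_nat_mul, Real.exp_log hn0]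
  have htwo : (2 : ℝ) ^ n = Real.exp (n * Real.log 2) := by
    rw [Real.exp_nat_mul, Real.exp_log (by norm_num)]
  set H : ℝ := n * ((2 * g / E) * (1 + Real.log (E / g))) with hH
  have hH0 : 0 ≤ H := by positivity
  calc _ ≤ Real.exp (n * Real.log 2) * Real.exp H ^ m * Real.exp (K * Real.log n) ^ m *
        Real.exp (-(E * Real.log 2) + Real.log n) ^ m := by
        rw [htwo, hpow]
        gcongr
    _ = Real.exp (n * Real.log 2 - (m * E) * Real.log 2 + m * (H + (K + 1) * Real.log n)) := by
        simp only [← Real.exp_nat_mul, ← Real.exp_add]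
        congr 1
        ring
    _ ≤ Real.exp (n * Real.log 2 - (2 * n - E) * Real.log 2 +
          3 * n / E * (H + (K + 1) * Real.log n)) := by
        have : 0 ≤ H + (K + 1) * Real.log n := by
          have : 0 ≤ Real.log n := by linarith
          positivity
        gcongr
    _ = _ := by
        congr 1
        rw [hH]
        field_simp
        ring

/-- The common sufficient condition behind both parameter regimes: the union bound over `τ` costs
`m log |I| = O(n log n / E)`, and the choice of the tuple around its first element costs
`O(n) * (n g / E²) * (1 + log (E / g))`. -/
theorem ensembleOGP_of_tendsto {E g : ℕ → ℝ} {m : ℕ → ℕ}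
    (hEo : E =o[atTop] fun n : ℕ => (n : ℝ))
    (hm : ∀ n : ℕ, |(m n : ℝ) - 2 * n / E n| < 1)
    (hg1 : ∀ᶠ n in atTop, 1 ≤ g n) (hgE : ∀ᶠ n in atTop, 4 * g n ≤ E n)
    (hlog : Tendsto (fun n : ℕ => Real.log n / E n) atTop (nhds 0))
    (hent : Tendsto (fun n : ℕ => n * g n / E n ^ 2 * (1 + Real.log (E n / g n))) atTop
      (nhds 0)) :
    ensembleOGP.{u} (fun n => 1 - 2 * g n / E n) (fun n => g n / (2 * n)) m E := by
  intro K
  refine ⟨1 / 2, by norm_num, ?_⟩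
  have hlim : Tendsto (fun n : ℕ => -Real.log 2 + E n / n * Real.log 2 +
      6 * (n * g n / E n ^ 2 * (1 + Real.log (E n / g n))) + 3 * (K + 1) * (Real.log n / E n))
      atTop (nhds (-Real.log 2 + 0 * Real.log 2 + 6 * 0 + 3 * (K + 1) * 0)) :=
    ((tendsto_const_nhds.add (hEo.tendsto_div_nhds_zero.mul_const _)).add
      (hent.const_mul _)).add (hlog.const_mul _)
  have hev := hlim.eventually_lt_const (u := -(1 / 2)) (by linarith [Real.log_two_gt_d9])
  filter_upwards [hev, hg1, hgE, hEo.bound one_pos, eventually_ge_atTop 2]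
    with n hrate hg hgE hEn hn I hI hcard Ω _ μ _ X hX hind
  have hn0 : (0 : ℝ) < n := by positivity
  have hE0 : 0 < E n := by linarith
  have hEn' : E n ≤ n := by
    rw [one_mul, Real.norm_of_nonneg hE0.le, Real.norm_of_nonneg hn0.le] at hEn
    exact hEn
  have hm' := abs_lt.1 (hm n)
  have hnE : 1 ≤ n / E n := by rw [le_div_iff₀ hE0]; linarith
  have hm0 : 0 < m n := by
    have : (0 : ℝ) < m n := by
      have : 2 * n / E n = 2 * (n / E n) := by ring
      linarith [hm'.1]
    exact_mod_cast this
  -- The overlap window is narrow enough for `m η` to use up only three quarters of `1 - β = 2g / E`.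
  have hmη : m n * (g n / (2 * n)) ≤ 3 / 2 * (g n / E n) := by
    have h1 : (m n : ℝ) ≤ 3 * (n / E n) := by
      have : 2 * n / E n = 2 * (n / E n) := by ring
      linarith [hm'.2]
    calc (m n : ℝ) * (g n / (2 * n)) ≤ 3 * (n / E n) * (g n / (2 * n)) := by gcongr
      _ = _ := by field_simp
  have hgE' : g n / E n ≤ 1 / 4 := by rw [div_le_iff₀ hE0]; linarith
  have hgn : g n / (2 * n) ≤ 2 * (g n / E n) := by
    calc g n / (2 * n) ≤ g n / (2 * E n) := by gcongr
      _ = 1 / 2 * (g n / E n) := by field_simp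
      _ ≤ _ := by
        have : 0 < g n / E n := by positivity
        linarith
  have e2 : 2 * g n / E n = 2 * (g n / E n) := by ring
  have e1 : g n / (2 * E n) = 1 / 2 * (g n / E n) := by field_simp
  have h := measure_nearGroundTuples_nonempty_le (l := g n / (2 * E n)) (ρ := 2 * g n / E n)
    (β := 1 - 2 * g n / E n) (η := g n / (2 * n)) (by omega) hm0 hX hind
    (by linarith) (by positivity) (by positivity) (by linarith) (by linarith)
    (by positivity) (by linarith) (by linarith) (E n) I hI
  have hcard' : (I.card : ℝ) ≤ (n : ℝ) ^ K := by exact_mod_cast hcard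
  calc _ ≤ _ := h
    _ ≤ 2 ^ n * Real.exp (n * ((2 * g n / E n) * (1 - Real.log (2 * g n / E n)))) ^ m n *
        ((n : ℝ) ^ K) ^ m n * ((2 : ℝ) ^ (-E n) / Real.sqrt (g n / (2 * E n))) ^ m n := by
        gcongr
    _ ≤ _ := firstMoment_bound_le hn hg hgE hEn' (hm n) K
    _ ≤ _ := by
        rw [Real.exp_le_exp]
        nlinarith

lemma one_le_logb_two {n : ℕ} (hn : 2 ≤ n) : 1 ≤ Real.logb 2 n := by
  rw [Real.le_logb_iff_rpow_le (by norm_num) (by positivity)]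
  simpa using (by exact_mod_cast hn : (2 : ℝ) ≤ n)

lemma log_le_logb_two (n : ℕ) : Real.log n ≤ Real.logb 2 n := by
  have h0 : 0 ≤ Real.log n := Real.log_natCast_nonneg n
  have hl2 : 0 < Real.log 2 := Real.log_pos (by norm_num)
  rw [Real.logb, le_div_iff₀ hl2]
  have := Real.log_two_lt_d9
  nlinarith

lemma ensembleOGP_of_isLittleO_sq {E : ℕ → ℝ} (hEpos : ∀ n, 0 < E n)
    (hEo : E =o[atTop] fun n : ℕ => (n : ℝ))
    {m : ℕ → ℕ} (hm : ∀ n : ℕ, |(m n : ℝ) - 2 * n / E n| < 1)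
    (hE : (fun n : ℕ => Real.sqrt (n * Real.logb 2 n)) =o[atTop] E)
    {g : ℕ → ℝ} (hg : Tendsto g atTop atTop)
    (hgo : g =o[atTop] fun n : ℕ => E n ^ 2 / (n * Real.logb 2 n)) :
    ensembleOGP.{u} (fun n => 1 - 2 * g n / E n) (fun n => g n / (2 * n)) m E := by
  have hg1 := hg.eventually_ge_atTop 1
  have hEn : ∀ᶠ n : ℕ in atTop, E n ≤ n := by
    filter_upwards [hEo.bound one_pos] with n hn
    rw [one_mul, Real.norm_of_nonneg (hEpos n).le, Real.norm_of_nonneg (by positivity)] at hn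
    exact hn
  refine ensembleOGP_of_tendsto hEo hm hg1 ?_ ?_ ?_
  · filter_upwards [hgo.bound (show (0 : ℝ) < 1 / 4 by norm_num), hg1, hEn, eventually_ge_atTop 2]
      with n h hg hEn hn
    have hE0 := hEpos n
    have hlb := one_le_logb_two hn
    have hn0 : (0 : ℝ) < n := by positivity
    rw [Real.norm_of_nonneg (by linarith), Real.norm_of_nonneg (by positivity)] at h
    have : E n ^ 2 / (n * Real.logb 2 n) ≤ E n := by
      rw [div_le_iff₀ (by positivity)]
      nlinarith [mul_le_mul_of_nonneg_left hlb hn0.le]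
    linarith
  · -- `log n / E ≤ √(n log₂ n) / E`
    refine squeeze_zero' (.of_forall fun n => div_nonneg (Real.log_natCast_nonneg n) (hEpos n).le)
      ?_ hE.tendsto_div_nhds_zero
    filter_upwards [eventually_ge_atTop 2] with n hn
    have hlb := one_le_logb_two hn
    have hn0 : (0 : ℝ) < n := by positivity
    have hE0 := hEpos n
    have h1 := log_le_logb_two n
    have h2 : Real.log n ≤ n := (Real.log_le_sub_one_of_pos hn0).trans (by linarith)
    have h0 := Real.log_natCast_nonneg n
    gcongr
    refine Real.le_sqrt_of_sq_le ?_
    nlinarith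
  -- Here `1 ≤ g` and `E ≤ n` give `log (E / g) ≤ log n ≤ log₂ n`.
  · have hlim : Tendsto (fun n : ℕ => 2 * (g n / (E n ^ 2 / (n * Real.logb 2 n)))) atTop
        (nhds 0) := by simpa using hgo.tendsto_div_nhds_zero.const_mul 2
    have hbd : ∀ᶠ n : ℕ in atTop, 0 ≤ n * g n / E n ^ 2 * (1 + Real.log (E n / g n)) ∧
        n * g n / E n ^ 2 * (1 + Real.log (E n / g n)) ≤
          2 * (g n / (E n ^ 2 / (n * Real.logb 2 n))) := by
      filter_upwards [hgo.bound (show (0 : ℝ) < 1 / 4 by norm_num), hg1, hEn,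
        eventually_ge_atTop 2] with n h hg hEn hn
      have hE0 := hEpos n
      have hlb := one_le_logb_two hn
      have hn0 : (0 : ℝ) < n := by positivity
      rw [Real.norm_of_nonneg (by linarith), Real.norm_of_nonneg (by positivity)] at h
      have hgE : E n ^ 2 / (n * Real.logb 2 n) ≤ E n := by
        rw [div_le_iff₀ (by positivity)]
        nlinarith [mul_le_mul_of_nonneg_left hlb hn0.le]
      have h1 : 0 ≤ Real.log (E n / g n) :=
        Real.log_nonneg (by rw [le_div_iff₀ (by linarith)]; linarith)
      have h2 : Real.log (E n / g n) ≤ Real.log n := by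
        refine Real.log_le_log (by positivity) ?_
        rw [div_le_iff₀ (by linarith)]
        nlinarith
      have h3 := log_le_logb_two n
      refine ⟨by positivity, ?_⟩
      calc _ ≤ n * g n / E n ^ 2 * (2 * Real.logb 2 n) := by gcongr; linarith
        _ = _ := by field_simp
    exact squeeze_zero' (hbd.mono fun _ h => h.1) (hbd.mono fun _ h => h.2) hlim

lemma ensembleOGP_of_rpow {E : ℕ → ℝ} (hEpos : ∀ n, 0 < E n)
    (hEo : E =o[atTop] fun n : ℕ => (n : ℝ))
    {m : ℕ → ℕ} (hm : ∀ n : ℕ, |(m n : ℝ) - 2 * n / E n| < 1)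
    {ε : ℝ} (hε : 0 < ε) (hε' : ε < 1 / 5)
    (hE : (fun n : ℕ => (n : ℝ) * Real.logb 2 n ^ (-(1 / 5) + ε)) =o[atTop] E)
    {g : ℕ → ℝ} (hg : ∀ n : ℕ, g n = n * (E n / n) ^ (2 + ε / 8)) :
    ensembleOGP.{u} (fun n => 1 - 2 * g n / E n) (fun n => g n / (2 * n)) m E := by
  have hs0 := hEo.tendsto_div_nhds_zero
  have hspos : ∀ᶠ n : ℕ in atTop, 0 < E n / n := by
    filter_upwards [eventually_gt_atTop 0] with n hn
    have := hEpos n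
    positivity
  have hs : Tendsto (fun n : ℕ => E n / n) atTop (nhdsWithin 0 (Set.Ioi 0)) :=
    tendsto_nhdsWithin_iff.2 ⟨hs0, hspos⟩
  have hs1 : ∀ᶠ n : ℕ in atTop, E n / n ≤ 1 / 4 := hs0.eventually_le_const (by norm_num)
  -- Only this weakening of the growth hypothesis is needed: the gain `ε` in the exponent is dropped.
  have hElow : ∀ᶠ n : ℕ in atTop, Real.logb 2 n ^ (-(1 / 5) : ℝ) ≤ E n / n := by
    filter_upwards [hE.bound one_pos, eventually_ge_atTop 2] with n h hn
    have hlb := one_le_logb_two hn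
    have hn0 : (0 : ℝ) < n := by positivity
    rw [one_mul, Real.norm_of_nonneg (by positivity), Real.norm_of_nonneg (hEpos n).le] at h
    rw [le_div_iff₀ hn0, mul_comm]
    refine le_trans ?_ h
    gcongr
    linarith
  refine ensembleOGP_of_tendsto hEo hm ?_ ?_ ?_ ?_
  · filter_upwards [hElow, hs1, hspos, eventually_ge_atTop 2] with n h h1 hpos hn
    have hlb := one_le_logb_two hn
    have hn0 : (0 : ℝ) < n := by positivity
    have h2 : Real.logb 2 n ^ (-1 : ℝ) ≤ (E n / n) ^ (2 + ε / 8) := by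
      calc Real.logb 2 n ^ (-1 : ℝ) ≤ Real.logb 2 n ^ (-(1 / 5) * 3 : ℝ) :=
            Real.rpow_le_rpow_of_exponent_le hlb (by norm_num)
        _ = (Real.logb 2 n ^ (-(1 / 5) : ℝ)) ^ (3 : ℝ) := by
            rw [Real.rpow_mul (by linarith)]
        _ ≤ (E n / n) ^ (3 : ℝ) := by gcongr
        _ ≤ _ := Real.rpow_le_rpow_of_exponent_ge hpos (by linarith) (by linarith)
    have h3 : Real.logb 2 n ≤ n := by
      rw [Real.logb_le_iff_le_rpow (by norm_num) hn0, Real.rpow_natCast]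
      exact_mod_cast Nat.lt_two_pow_self.le
    rw [hg n]
    calc (1 : ℝ) = Real.logb 2 n * Real.logb 2 n ^ (-1 : ℝ) := by
          rw [Real.rpow_neg_one, mul_inv_cancel₀ (by linarith)]
      _ ≤ _ := by gcongr
  · filter_upwards [hs1, hspos, eventually_ge_atTop 2] with n h1 hpos hn
    have hn0 : (0 : ℝ) < n := by positivity
    have h2 : (E n / n) ^ (2 + ε / 8) ≤ (E n / n) ^ (2 : ℝ) :=
      Real.rpow_le_rpow_of_exponent_ge hpos (by linarith) (by linarith)
    rw [Real.rpow_two] at h2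
    rw [hg n]
    calc 4 * (n * (E n / n) ^ (2 + ε / 8)) ≤ 4 * (n * (1 / 4 * (E n / n))) := by
          gcongr
          refine h2.trans ?_
          rw [sq]
          gcongr
      _ = _ := by field_simp
  -- Here `E ≥ n / log₂ n`, so `log n / E` is at most `(log n)² / (n log 2)`.
  · have hlim : Tendsto (fun n : ℕ => (1 / Real.log 2) * (Real.log n ^ 2 / n)) atTop (nhds 0) := by
      have h := ((Real.isLittleO_pow_log_id_atTop (n := 2)).tendsto_div_nhds_zero).comp
        tendsto_natCast_atTop_atTop
      simpa using h.const_mul (1 / Real.log 2)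
    refine squeeze_zero' (.of_forall fun n => div_nonneg (Real.log_natCast_nonneg n) (hEpos n).le)
      ?_ hlim
    filter_upwards [hElow, eventually_ge_atTop 2] with n h hn
    have hlb := one_le_logb_two hn
    have hn0 : (0 : ℝ) < n := by positivity
    have hl0 := Real.log_natCast_nonneg n
    have h1 : Real.logb 2 n ^ (-1 : ℝ) ≤ E n / n :=
      (Real.rpow_le_rpow_of_exponent_le hlb (by norm_num)).trans h
    rw [Real.rpow_neg_one, inv_le_comm₀ (by linarith) (div_pos (hEpos n) hn0), inv_div] at h1
    calc Real.log n / E n = Real.log n * (n / E n) / n := by field_simp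
      _ ≤ Real.log n * Real.logb 2 n / n := by gcongr
      _ = _ := by rw [Real.logb]; ring
  -- With `s = E / n`, the quantity is `s ^ (ε / 8) * (1 - (1 + ε / 8) * log s)`, and `s → 0`.
  · have hlim : Tendsto (fun n : ℕ => (E n / n) ^ (ε / 8) -
        (1 + ε / 8) * (Real.log (E n / n) * (E n / n) ^ (ε / 8))) atTop (nhds 0) := by
      have ha := (tendsto_log_mul_rpow_nhdsGT_zero (r := ε / 8) (by positivity)).comp hs
      have hb := hs0.rpow_const (p := ε / 8) (Or.inr (by positivity))
      rw [Real.zero_rpow (by positivity)] at hb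
      simpa using hb.sub (ha.const_mul (1 + ε / 8))
    refine hlim.congr' ?_
    filter_upwards [hspos, eventually_ge_atTop 2] with n hpos hn
    have hn0 : (0 : ℝ) < n := by positivity
    have hE0 := hEpos n
    have hratio : E n / g n = (E n / n) ^ (-(1 + ε / 8)) := by
      rw [hg n, Real.rpow_neg hpos.le, show 2 + ε / 8 = (1 + ε / 8) + 1 by ring,
        Real.rpow_add_one hpos.ne']
      field_simp
    have hcoef : n * g n / E n ^ 2 = (E n / n) ^ (ε / 8) := by
      rw [hg n, add_comm, Real.rpow_add hpos, Real.rpow_two]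
      field_simp
    rw [hratio, hcoef, Real.log_rpow hpos]
    ring

theorem theorem2p4 (E : ℕ → ℝ) (hEpos : ∀ n, 0 < E n)
    (hEo : E =o[atTop] fun n : ℕ => (n : ℝ))
    (m : ℕ → ℕ) (hm : ∀ n : ℕ, |(m n : ℝ) - 2 * n / E n| < 1) :
    ((fun n : ℕ => Real.sqrt (n * Real.logb 2 n)) =o[atTop] E →
      ∀ g : ℕ → ℝ, Tendsto g atTop atTop →
        (g =o[atTop] fun n : ℕ => E n ^ 2 / (n * Real.logb 2 n)) →
        ensembleOGP.{u} (fun n => 1 - 2 * g n / E n) (fun n => g n / (2 * n)) m E) ∧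
    (∀ ε : ℝ, 0 < ε → ε < 1 / 5 →
      (fun n : ℕ => (n : ℝ) * Real.logb 2 n ^ (-(1 / 5) + ε)) =o[atTop] E →
      ∀ g : ℕ → ℝ, (∀ n : ℕ, g n = n * (E n / n) ^ (2 + ε / 8)) →
        ensembleOGP.{u} (fun n => 1 - 2 * g n / E n) (fun n => g n / (2 * n)) m E) :=
  ⟨fun hE _ hg hgo => ensembleOGP_of_isLittleO_sq hEpos hEo hm hE hg hgo,
    fun _ hε hε' hE _ hg => ensembleOGP_of_rpow hEpos hEo hm hε hε' hE hg⟩
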